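/- **Conventions.** Let $n\ge 0$ and let $w=w_1\cdots w_n$ be a standard word, i.e. a permutation of $1,\dots,n$. $P(\cdot)$ denotes the (row-insertion) Schensted insertion tableau, in English notation. The word of a tableau is its row reading word (rows from bottom to top, each from left to right), and for tableaux $U,V$, $P(UV)$ means $P$ of the word of $U$ followed by the word of $V$. *Catabolizability.* Let $T$ be a tableau with distinct entries. If the first row of $T$ has at least $m$ squares, let $T_{(m)}$ be the part of $T$ consisting of the first $m$ squares of the first row, and let $\mathrm{Cat}_m(T)=P(T_nT_s)$, where $T_n$ is the rest of the first row and $T_s$ consists of the rows of $T$ below the first. The empty tableau is $\varnothing$-catabolizable; for a partition $\lambda=(\lambda_1,\widehat\lambda)$ of $|T|\geq 1$, $T$ is $\lambda$-catabolizable if $T_{(\lambda_1)}$ exists and contains the $\lambda_1$ smallest entries of $T$, and $\mathrm{Cat}_{\lambda_1}(T)$ is $\widehat\lambda$-catabolizable. Write $\mathrm{ctype}(w)$ for the largest partition $\lambda$, in dominance order, such that $P(w)$ is $\lambda$-catabolizable. *The map $\tilde w$.* The cocharge labeling $z=z_1\cdots z_n$ of $w$ labels the letter $1$ of $w$ by $0$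 and, if the letter $i$ is labeled $k$, labels the letter $i+1$ by $k$ if it stands to the right of $i$ in $w$ and by $k+1$ if it stands to the left; $z_p$ is the label of $w_p$. Define $\tilde w:\mathbb Z_{\le n}\to\mathbb Z_{\ge 0}$ by $\tilde w(i)=z_{i+kn}+k$, where $k$ is the unique integer with $1\le i+kn\le n$ (for $n=0$ the only chain family below is the empty one). *Chains.* A chain of $\tilde w$ of length $k'+1\ge 1$ is a sequence $(j_{k'},\dots,j_0)$ of integers $\le n$ with $j_{k'}<\dots<j_0$, with $\tilde w(j_i)=i$ for all $i\in[0,k']$, and with $j_0,\dots,j_{k'}$ pairwise incongruent modulo $n$. A $k$-bounded chain family of $\tilde w$ is a finite set of chains of $\tilde w$ of lengths at most $k$ whose sets of residues modulo $n$ are pairwise disjoint. **Theorem.** If $\mathrm{ctype}(w)=\lambda$, then $\tilde w$ has an $\ell(\lambda)$-bounded chain family consisting of exactly $\lambda_1$ chains, whose lengths are (as a multiset) $\lambda'_1,\lambda'_2,\dots,\lambda'_{\lambda_1}$, where $\ell(\lambda)$ is the number of parts of $\lambda$ and $\lambda'$ is the conjugate partition. -/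

import Mathlib

namespace Catabolism

/-! Words are lists of natural numbers, and a tableau (English notation) is the list of its
rows, from north to south; the empty tableau is `[]`. -/

/-- A standard word of length `n`: a word that uses each of `1, …, n` exactly once. -/
def IsStandardWord (n : ℕ) (w : List ℕ) : Prop :=
  w.Perm (List.range' 1 n)

/-! ### Schensted insertion -/

/-- Row-insert `x` into one row: `x` replaces the first entry larger than `x`, which is bumped;
if there is none, `x` is appended and nothing is bumped. -/
def rowInsert (x : ℕ) : List ℕ → List ℕ × Option ℕ
  | [] => ([x], none)
  | y :: ys =>
    if x < y then (x :: ys, some y)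
    else (y :: (rowInsert x ys).1, (rowInsert x ys).2)

/-- Row-insert `x` into a tableau: a bumped entry is inserted into the next row. -/
def tableauInsert (x : ℕ) : List (List ℕ) → List (List ℕ)
  | [] => [[x]]
  | r :: rs =>
    match rowInsert x r with
    | (r', none) => r' :: rs
    | (r', some y) => r' :: tableauInsert y rs

/-- The insertion tableau `P(w)`. -/
def insertionTableau (w : List ℕ) : List (List ℕ) :=
  w.foldl (fun T x => tableauInsert x T) []

/-- The row reading word: rows from south to north, each from west to east. -/
def rowWord (T : List (List ℕ)) : List ℕ :=
  T.reverse.flatten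

/-! ### Catabolizability -/

/-- The subtableau `T_(m)` of one-row shape `(m)`, as a word (used only if `(m) ⊆ sh(T)`). -/
def firstRowTake (m : ℕ) (T : List (List ℕ)) : List ℕ :=
  (T.headD []).take m

/-- The north part of the skew tableau `T - T_(m)` sliced below its first row. -/
def northPart (m : ℕ) (T : List (List ℕ)) : List ℕ :=
  (T.headD []).drop m

/-- The south part of the skew tableau `T - T_(m)` sliced below its first row. -/
def southPart (T : List (List ℕ)) : List (List ℕ) :=
  T.tail

/-- The `m`-catabolism `Cat_m(T) = P(T_n T_s)`, where `T_n` and `T_s` are the north and south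
parts of `T - T_(m)`. -/
def cat (m : ℕ) (T : List (List ℕ)) : List (List ℕ) :=
  insertionTableau (northPart m T ++ rowWord (southPart T))

/-- `T` is catabolizable with respect to the partition with the given list of parts: `T_(m)`
exists and contains the `m` smallest entries of `T`, where `m` is the first part, and `Cat_m(T)`
is catabolizable with respect to the remaining parts. (The entries of `T` are distinct.) -/
def IsCatabolizable : List (List ℕ) → List ℕ → Prop
  | T, [] => T = []
  | T, m :: ms =>
    m ≤ (T.headD []).length ∧
    (∀ a ∈ firstRowTake m T, ∀ b ∈ northPart m T ++ rowWord (southPart T), a < b) ∧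
    IsCatabolizable (cat m T) ms

/-- Dominance order on partitions: `μ ⊴ lam`. -/
def DominatedBy (μ lam : YoungDiagram) : Prop :=
  μ.card = lam.card ∧
  ∀ k : ℕ, ∑ i ∈ Finset.range k, μ.rowLen i ≤ ∑ i ∈ Finset.range k, lam.rowLen i

/-- `ctype(T) = lam`: among the partitions `μ` for which `T` is `μ`-catabolizable, `lam` is the
largest one in dominance order. -/
def TableauCtypeEq (T : List (List ℕ)) (lam : YoungDiagram) : Prop :=
  IsCatabolizable T lam.rowLens ∧
  ∀ μ : YoungDiagram, IsCatabolizable T μ.rowLens → DominatedBy μ lam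

/-- `ctype(w) = lam`, where `ctype(w) = ctype(P(w))`. -/
def CtypeEq (w : List ℕ) (lam : YoungDiagram) : Prop :=
  TableauCtypeEq (insertionTableau w) lam

/-! ### Cocharge labeling and chains -/

/-- The label that the number `i` gets in the cocharge labeling of `w` (the value at `0` is
irrelevant). -/
def cochargeLabel (w : List ℕ) : ℕ → ℕ
  | 0 => 0
  | 1 => 0
  | i + 2 =>
    if w.idxOf (i + 2) < w.idxOf (i + 1) then cochargeLabel w (i + 1) + 1
    else cochargeLabel w (i + 1)

/-- The cocharge labeling of `w`. -/
def cochargeLabeling (w : List ℕ) : List ℕ :=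
  w.map (cochargeLabel w)

/-- The integer `k` with `i + k n ∈ [1, n]`; see `windowShift_spec`. -/
def windowShift (n : ℕ) (i : ℤ) : ℤ := ((n : ℤ) - i) / n

theorem windowShift_spec {n : ℕ} (hn : 0 < n) (i k : ℤ) :
    (1 ≤ i + k * n ∧ i + k * n ≤ n) ↔ k = windowShift n i := by
  have hn' : (0 : ℤ) < n := by exact_mod_cast hn
  unfold windowShift
  rw [eq_comm, Int.ediv_eq_iff_of_pos hn']
  constructor
  · rintro ⟨h1, h2⟩
    constructor <;> linarith
  · rintro ⟨h1, h2⟩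
    constructor <;> linarith

/-- The map `w̃`, `i ↦ z_{i + k n} + k` with `k = windowShift n i` and `z` the cocharge labeling
of `w` (positions in `z` count from `1`). Only its values at `i ≤ n` matter. -/
def tilde (n : ℕ) (w : List ℕ) (i : ℤ) : ℤ :=
  ((cochargeLabeling w).getD (i + windowShift n i * n - 1).toNat 0 : ℤ) + windowShift n i

/-- `j = [j_{k'}, …, j_0]` is a chain of the map `f : ℤ_{≤ n} → ℤ`. Its length is `k' + 1`. -/
structure IsChainOf (n : ℕ) (f : ℤ → ℤ) (j : List ℤ) : Prop where
  ne_nil : j ≠ []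
  le_n : ∀ x ∈ j, x ≤ (n : ℤ)
  strictly_increasing : j.Pairwise (· < ·)
  values : j.reverse.map f = (List.range j.length).map (fun i : ℕ => (i : ℤ))
  residues_distinct : (j.map (fun x => (x : ZMod n))).Nodup

/-- The set of classes mod `n` of the members of a chain. -/
def residues (n : ℕ) (j : List ℤ) : Set (ZMod n) :=
  {a | ∃ x ∈ j, (x : ZMod n) = a}

/-- `A` is a `k`-bounded chain family of `f`. -/
structure IsBoundedChainFamily (n : ℕ) (f : ℤ → ℤ) (k : ℕ) (A : Finset (List ℤ)) : Prop where
  isChain : ∀ j ∈ A, IsChainOf n f j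
  length_le : ∀ j ∈ A, j.length ≤ k
  residues_disjoint : ∀ j ∈ A, ∀ j' ∈ A, j ≠ j' → Disjoint (residues n j) (residues n j')

end Catabolism

/-! A chain can be recorded by letters: in row `i` of a column, a letter `a` stands for the integer
congruent to its position in `w` at which `w̃` takes the value `i`. Passing from `a` in row `i` to
`b` in row `i + 1` lowers this integer exactly when `ChainStep` holds, a condition free of `i`. So
it suffices to fill the diagram of `λ` with distinct letters whose columns are such chains and start
at label 0; column `j` then gives a chain of length `λ'_j`.

The filling is built by induction on the parts of `λ`. Row insertion is a sequence of Knuth steps,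
which keep the labeling (`KnuthStep.isCochargeLabeling`), and a filling can be pulled back through
each of them (`KnuthStep.exists_isChainFilling`). Hence `w` may be replaced by the row word of
`P(w)`, which is `a ++ [s, …, s + m - 1] ++ c`. Catabolism passes to `c ++ a`, whose labels are the
old ones on `c` and one less on `a`. A filling for `c ++ a` stays valid for the old word, and the
removed interval, all labeled 0, becomes its new first row (`IsChainFilling.cons`). -/

namespace Catabolism

/-! ### Row insertion as a sequence of Knuth transformations -/

/-- The two elementary Knuth transformations, in the direction in which row insertion uses
them. -/
inductive KnuthStep : List ℕ → List ℕ → Prop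
  | moveLeft (p q : List ℕ) {x y z : ℕ} (hxy : x < y) (hyz : y ≤ z) :
      KnuthStep (p ++ y :: z :: x :: q) (p ++ y :: x :: z :: q)
  | bumpLeft (p q : List ℕ) {x y z : ℕ} (hxy : x ≤ y) (hyz : y < z) :
      KnuthStep (p ++ x :: z :: y :: q) (p ++ z :: x :: y :: q)

/-- Reachability by Knuth transformations. -/
abbrev KnuthReduces : List ℕ → List ℕ → Prop := Relation.ReflTransGen KnuthStep

theorem KnuthStep.perm {u v : List ℕ} (h : KnuthStep u v) : u.Perm v := by
  cases h with
  | moveLeft p q => exact ((List.Perm.swap _ _ _).cons _).append_left p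
  | bumpLeft p q => exact (List.Perm.swap _ _ _).append_left p

theorem KnuthReduces.perm {u v : List ℕ} (h : KnuthReduces u v) : u.Perm v := by
  induction h with
  | refl => exact List.Perm.refl _
  | tail _ h ih => exact ih.trans h.perm

theorem KnuthStep.context {u v : List ℕ} (h : KnuthStep u v) (a b : List ℕ) :
    KnuthStep (a ++ u ++ b) (a ++ v ++ b) := by
  cases h with
  | moveLeft p q hxy hyz => simpa using KnuthStep.moveLeft (a ++ p) (q ++ b) hxy hyz
  | bumpLeft p q hxy hyz => simpa using KnuthStep.bumpLeft (a ++ p) (q ++ b) hxy hyz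

theorem KnuthReduces.context {u v : List ℕ} (h : KnuthReduces u v) (a b : List ℕ) :
    KnuthReduces (a ++ u ++ b) (a ++ v ++ b) := by
  induction h with
  | refl => exact Relation.ReflTransGen.refl
  | tail _ h ih => exact ih.tail (h.context a b)

/-- Each letter that `x` passes has a left neighbour larger than `x`, which serves as witness for
`moveLeft`; only the first letter lacks one. -/
theorem knuthReduces_move_left (x : ℕ) (ys : List ℕ) :
    ∀ y, x < y → (y :: ys).Pairwise (· ≤ ·) → KnuthReduces (y :: ys ++ [x]) (y :: x :: ys) := by
  induction ys with
  | nil => intro y _ _; exact Relation.ReflTransGen.refl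
  | cons t ts ih =>
    intro y hxy hs
    have hyt : y ≤ t := List.rel_of_pairwise_cons hs (by simp)
    have h1 := (ih t (by omega) hs.of_cons).context [y] []
    have h2 := KnuthStep.moveLeft [] ts hxy hyt
    simp only [List.append_nil, List.nil_append, List.singleton_append] at h1 h2
    exact Relation.ReflTransGen.tail h1 h2

theorem rowInsert_mem {x a : ℕ} {r : List ℕ} (h : a ∈ (rowInsert x r).1) : a = x ∨ a ∈ r := by
  induction r with
  | nil => simpa [rowInsert] using h
  | cons y ys ih =>
    unfold rowInsert at h
    split at h <;> simp at h ⊢ <;> tauto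

theorem rowInsert_sorted (x : ℕ) {r : List ℕ} (h : r.Pairwise (· ≤ ·)) :
    (rowInsert x r).1.Pairwise (· ≤ ·) := by
  induction r with
  | nil => simp [rowInsert]
  | cons y ys ih =>
    rw [List.pairwise_cons] at h
    unfold rowInsert
    split
    · next hxy =>
      refine List.pairwise_cons.2 ⟨fun a ha => ?_, h.2⟩
      have := h.1 a ha
      omega
    · next hxy =>
      refine List.pairwise_cons.2 ⟨fun a ha => ?_, ih h.2⟩
      rcases rowInsert_mem ha with rfl | ha
      · omega
      · exact h.1 a ha

theorem rowInsert_eq_append {x : ℕ} {r r' : List ℕ} (h : rowInsert x r = (r', none)) :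
    r' = r ++ [x] := by
  induction r generalizing r' with
  | nil => simpa [rowInsert, eq_comm] using h
  | cons y ys ih =>
    unfold rowInsert at h
    split at h
    · simp at h
    · simp only [Prod.mk.injEq] at h
      rw [← h.1, ih (r' := (rowInsert x ys).1) (Prod.ext rfl h.2)]
      rfl

/-- The head of the new row is the witness that lets the bumped letter jump further left by
`bumpLeft`. -/
theorem rowInsert_head_lt {x b : ℕ} {r r' : List ℕ} (hs : r.Pairwise (· ≤ ·))
    (h : rowInsert x r = (r', some b)) : ∃ c t, r' = c :: t ∧ c < b := by
  induction r generalizing r' with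
  | nil => simp [rowInsert] at h
  | cons y ys ih =>
    unfold rowInsert at h
    split at h
    · next hxy =>
      simp only [Prod.mk.injEq, Option.some.injEq] at h
      exact ⟨x, ys, h.1.symm, by omega⟩
    · simp only [Prod.mk.injEq] at h
      obtain ⟨c, t, hc, hcb⟩ := ih (r' := (rowInsert x ys).1) hs.of_cons (Prod.ext rfl h.2)
      refine ⟨y, _, h.1.symm, ?_⟩
      have hcm : c ∈ (rowInsert x ys).1 := by rw [hc]; simp
      rcases rowInsert_mem hcm with rfl | hcm
      · omega
      · exact (List.rel_of_pairwise_cons hs hcm).trans_lt hcb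

/-- First `x` travels left until it stands just after the letter `b` that it bumps; then `b` passes
the smaller entries one by one. -/
theorem knuthReduces_rowInsert {x b : ℕ} {r r' : List ℕ} (hs : r.Pairwise (· ≤ ·))
    (h : rowInsert x r = (r', some b)) : KnuthReduces (r ++ [x]) (b :: r') := by
  induction r generalizing r' with
  | nil => simp [rowInsert] at h
  | cons y ys ih =>
    unfold rowInsert at h
    split at h
    · next hxy =>
      simp only [Prod.mk.injEq, Option.some.injEq] at h
      obtain ⟨rfl, rfl⟩ := h
      exact knuthReduces_move_left x ys y hxy hs
    · next hxy =>
      simp only [Prod.mk.injEq] at h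
      have h0 : rowInsert x ys = ((rowInsert x ys).1, some b) := Prod.ext rfl h.2
      obtain ⟨c, t, hc, hcb⟩ := rowInsert_head_lt hs.of_cons h0
      have hyc : y ≤ c := by
        have hcm : c ∈ (rowInsert x ys).1 := by rw [hc]; simp
        rcases rowInsert_mem hcm with rfl | hcm
        · omega
        · exact List.rel_of_pairwise_cons hs hcm
      have h1 := (ih hs.of_cons h0).context [y] []
      have h2 := KnuthStep.bumpLeft [] t hyc hcb
      rw [← h.1, hc]
      rw [hc] at h1
      simp only [List.append_nil, List.nil_append, List.singleton_append] at h1 h2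
      exact Relation.ReflTransGen.tail h1 h2

theorem rowWord_cons (r : List ℕ) (rs : List (List ℕ)) : rowWord (r :: rs) = rowWord rs ++ r := by
  simp [rowWord]

theorem tableauInsert_sorted (x : ℕ) {T : List (List ℕ)} (h : ∀ r ∈ T, r.Pairwise (· ≤ ·)) :
    ∀ r ∈ tableauInsert x T, r.Pairwise (· ≤ ·) := by
  induction T generalizing x with
  | nil => simp [tableauInsert]
  | cons r rs ih =>
    have hr := rowInsert_sorted x (h r (by simp))
    have hrs : ∀ r ∈ rs, r.Pairwise (· ≤ ·) := fun r' hr' => h r' (by simp [hr'])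
    unfold tableauInsert
    split <;> next heq =>
      rw [heq] at hr
      intro r' hr'
      rcases List.mem_cons.1 hr' with rfl | hr'
      · exact hr
      · first
        | exact hrs r' hr'
        | exact ih _ hrs r' hr'

/-- In the row word, a letter bumped to the front of its row follows the lower rows directly, ready
for insertion there. -/
theorem knuthReduces_tableauInsert (x : ℕ) {T : List (List ℕ)}
    (h : ∀ r ∈ T, r.Pairwise (· ≤ ·)) :
    KnuthReduces (rowWord T ++ [x]) (rowWord (tableauInsert x T)) := by
  induction T generalizing x with
  | nil => exact Relation.ReflTransGen.refl
  | cons r rs ih =>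
    have hrs : ∀ r ∈ rs, r.Pairwise (· ≤ ·) := fun r' hr' => h r' (by simp [hr'])
    unfold tableauInsert
    split
    · next heq =>
      rw [rowInsert_eq_append heq, rowWord_cons, rowWord_cons, List.append_assoc]
    · next r' b heq =>
      have h1 := (knuthReduces_rowInsert (h r (by simp)) heq).context (rowWord rs) []
      have h2 := (ih b hrs).context [] r'
      rw [rowWord_cons, rowWord_cons]
      simp only [List.append_nil, List.nil_append, List.append_assoc,
        List.singleton_append] at h1 h2 ⊢
      exact h1.trans h2

theorem insertionTableau_concat (w : List ℕ) (x : ℕ) :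
    insertionTableau (w ++ [x]) = tableauInsert x (insertionTableau w) := by
  simp [insertionTableau]

theorem insertionTableau_sorted (w : List ℕ) :
    ∀ r ∈ insertionTableau w, r.Pairwise (· ≤ ·) := by
  induction w using List.reverseRecOn with
  | nil => simp [insertionTableau]
  | append_singleton w x ih =>
    rw [insertionTableau_concat]
    exact tableauInsert_sorted x ih

theorem knuthReduces_rowWord_insertionTableau (w : List ℕ) :
    KnuthReduces w (rowWord (insertionTableau w)) := by
  induction w using List.reverseRecOn with
  | nil => exact Relation.ReflTransGen.refl
  | append_singleton w x ih =>
    rw [insertionTableau_concat]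
    have h1 := ih.context [] [x]
    exact Relation.ReflTransGen.trans h1
      (knuthReduces_tableauInsert x (insertionTableau_sorted w))

/-! ### Cocharge labelings of words on an interval of letters -/

/-- `z` restricts to the cocharge labeling of the word `w` in the letters
`s, s + 1, …, s + len - 1`, the smallest of which is labeled `0`. -/
structure IsCochargeLabeling (w : List ℕ) (s len : ℕ) (z : ℕ → ℤ) : Prop where
  start : 0 < len → z s = 0
  succ : ∀ i, s ≤ i → i + 1 < s + len →
    z (i + 1) = z i + if w.idxOf (i + 1) < w.idxOf i then 1 else 0

/-- Labels never drop, and a constant label means that each next letter stands no further left. -/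
theorem IsCochargeLabeling.le_and_idxOf_le {w : List ℕ} {s len : ℕ} {z : ℕ → ℤ}
    (hz : IsCochargeLabeling w s len z) {a b : ℕ} (ha : s ≤ a) (hab : a ≤ b) (hb : b < s + len) :
    z a ≤ z b ∧ (z a = z b → w.idxOf a ≤ w.idxOf b) := by
  induction b, hab using Nat.le_induction with
  | base => simp
  | succ b hab ih =>
    have h1 := ih (by omega)
    have h2 := hz.succ b (by omega) hb
    split_ifs at h2
    · omega
    · exact ⟨by omega, fun h => (h1.2 (by omega)).trans (by omega)⟩

/-- A letter labeled like `a` may be followed in a chain by `b`. -/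
def ChainStep (w : List ℕ) (z : ℕ → ℤ) (a b : ℕ) : Prop :=
  z b ≤ z a ∨ z b ≤ z a + 1 ∧ w.idxOf b < w.idxOf a

/-- The filling whose row `i + 1` is the row `i` of `F`, and whose first row is
`s, s + 1, s + 2, …`. -/
def consFilling (s : ℕ) (F : ℕ → ℕ → ℕ) : ℕ → ℕ → ℕ
  | 0, j => s + j
  | i + 1, j => F i j

/-- `F` fills the diagram with row lengths `ms` with distinct letters of `w`, so that each column
read downwards is a chain, written in letters. -/
structure IsChainFilling (w : List ℕ) (z : ℕ → ℤ) (ms : List ℕ) (F : ℕ → ℕ → ℕ) : Prop where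
  mem : ∀ i j, j < ms.getD i 0 → F i j ∈ w
  inj : ∀ i j i' j', j < ms.getD i 0 → j' < ms.getD i' 0 → F i j = F i' j' → i = i' ∧ j = j'
  start : ∀ j, j < ms.getD 0 0 → z (F 0 j) = 0
  step : ∀ i j, j < ms.getD i 0 → j < ms.getD (i + 1) 0 → ChainStep w z (F i j) (F (i + 1) j)

/-! ### Knuth invariance -/

theorem idxOf_append_three {p q : List ℕ} {x y z : ℕ} (h : (p ++ x :: y :: z :: q).Nodup) :
    (p ++ x :: y :: z :: q).idxOf x = p.length ∧
    (p ++ x :: y :: z :: q).idxOf y = p.length + 1 ∧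
    (p ++ x :: y :: z :: q).idxOf z = p.length + 2 := by
  have hd := List.nodup_append.1 h
  have hx : x ∉ p := fun hp => hd.2.2 x hp x (by simp) rfl
  have hy : y ∉ p := fun hp => hd.2.2 y hp y (by simp) rfl
  have hz : z ∉ p := fun hp => hd.2.2 z hp z (by simp) rfl
  have hn := hd.2.1
  simp only [List.nodup_cons, List.mem_cons, not_or] at hn
  obtain ⟨⟨hxy, hxz, -⟩, ⟨hyz, -⟩, -⟩ := hn
  simp [List.idxOf_append, hx, hy, hz, hxy, hxz, hyz, Nat.add_comm]

theorem idxOf_append_three_of_ne (p q : List ℕ) {x y z t : ℕ} (hx : t ≠ x) (hy : t ≠ y)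
    (hz : t ≠ z) :
    (p ++ x :: y :: z :: q).idxOf t =
      if t ∈ p then p.idxOf t else q.idxOf t + 3 + p.length := by
  simp [List.idxOf_append, hx.symm, hy.symm, hz.symm]

/-- The effect of a Knuth transformation of a word with distinct letters on the positions. -/
theorem KnuthStep.exists_idxOf {u v : List ℕ} (h : KnuthStep u v) (hu : u.Nodup) :
    ∃ x y z N, x < y ∧ y < z ∧ x ∈ u ∧ y ∈ u ∧ z ∈ u ∧
      (∀ t, t ≠ x → t ≠ y → t ≠ z →
        v.idxOf t = u.idxOf t ∧ (u.idxOf t < N ∨ N + 2 < u.idxOf t)) ∧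
      (u.idxOf y = N ∧ u.idxOf z = N + 1 ∧ u.idxOf x = N + 2 ∧
          v.idxOf y = N ∧ v.idxOf x = N + 1 ∧ v.idxOf z = N + 2 ∨
        u.idxOf x = N ∧ u.idxOf z = N + 1 ∧ u.idxOf y = N + 2 ∧
          v.idxOf z = N ∧ v.idxOf x = N + 1 ∧ v.idxOf y = N + 2) := by
  have hv : v.Nodup := h.perm.nodup_iff.1 hu
  cases h with
  | @moveLeft p q x y z hxy hyz =>
    have h1 := idxOf_append_three hu
    have h2 := idxOf_append_three hv
    have hne : y ≠ z := by rintro rfl; omega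
    refine ⟨x, y, z, p.length, hxy, by omega, by simp, by simp, by simp, fun t hx hy hz => ?_,
      Or.inl ⟨h1.1, h1.2.1, h1.2.2, h2⟩⟩
    rw [idxOf_append_three_of_ne p q hy hz hx, idxOf_append_three_of_ne p q hy hx hz]
    refine ⟨rfl, ?_⟩
    split_ifs with hp
    · exact Or.inl (List.idxOf_lt_length_iff.2 hp)
    · omega
  | @bumpLeft p q x y z hxy hyz =>
    have h1 := idxOf_append_three hu
    have h2 := idxOf_append_three hv
    have hne : x ≠ y := by rintro rfl; omega
    refine ⟨x, y, z, p.length, by omega, hyz, by simp, by simp, by simp, fun t hx hy hz => ?_,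
      Or.inr ⟨h1.1, h1.2.1, h1.2.2, h2⟩⟩
    rw [idxOf_append_three_of_ne p q hx hz hy, idxOf_append_three_of_ne p q hz hx hy]
    refine ⟨rfl, ?_⟩
    split_ifs with hp
    · exact Or.inl (List.idxOf_lt_length_iff.2 hp)
    · omega

/-- Only the relative order of the letters `x < z` changes, and `x < y < z` for some `y`. -/
theorem KnuthStep.isCochargeLabeling {u v : List ℕ} (h : KnuthStep u v) {s len : ℕ} {ℓ : ℕ → ℤ}
    (hu : u.Nodup) (hz : IsCochargeLabeling u s len ℓ) : IsCochargeLabeling v s len ℓ := by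
  refine ⟨hz.start, fun i hi hi' => ?_⟩
  rw [hz.succ i hi hi']
  congr 1
  refine if_congr ?_ rfl rfl
  obtain ⟨x, y, z, N, hxy, hyz, -, -, -, ht, hpos⟩ := h.exists_idxOf hu
  have h1 := ht i
  have h2 := ht (i + 1)
  by_cases i = x <;> by_cases i = y <;> by_cases i = z <;> by_cases i + 1 = x <;>
    by_cases i + 1 = y <;> by_cases i + 1 = z <;> first | omega | (subst_vars; omega)

theorem IsChainFilling.of_step {u v : List ℕ} {ℓ : ℕ → ℤ} {ms : List ℕ} {F : ℕ → ℕ → ℕ}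
    (hF : IsChainFilling v ℓ ms F) (hmem : ∀ a, a ∈ v → a ∈ u)
    (hstep : ∀ i j, j < ms.getD i 0 → j < ms.getD (i + 1) 0 → ChainStep v ℓ (F i j) (F (i + 1) j) →
      ChainStep u ℓ (F i j) (F (i + 1) j)) : IsChainFilling u ℓ ms F :=
  ⟨fun i j h => hmem _ (hF.mem i j h), hF.inj, hF.start,
    fun i j h h' => hstep i j h h' (hF.step i j h h')⟩

/-- The filling itself works unless the step is `x z y → z x y` and some column has `z` directly
below `x` and needs `z` to be left of `x`. Then `x` and `y` have the same label, and exchanging them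
repairs the filling. -/
theorem KnuthStep.exists_isChainFilling {u v : List ℕ} (h : KnuthStep u v) {s len : ℕ}
    {ℓ : ℕ → ℤ} {ms : List ℕ} (hu : u.Perm (List.range' s len))
    (hz : IsCochargeLabeling u s len ℓ) (hF : ∃ F, IsChainFilling v ℓ ms F) :
    ∃ F, IsChainFilling u ℓ ms F := by
  obtain ⟨F, hF⟩ := hF
  have hmem : ∀ a, a ∈ v → a ∈ u := fun a => h.perm.mem_iff.2
  have hnd : u.Nodup := hu.nodup_iff.2 List.nodup_range'
  obtain ⟨x, y, z, N, hxy, hyz, hx, hy, hzu, ht, hpos⟩ := h.exists_idxOf hnd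
  have hmem' : ∀ a ∈ u, s ≤ a ∧ a < s + len := fun a ha => by
    simpa using hu.mem_iff.1 ha
  have hxlab := hz.le_and_idxOf_le (hmem' x hx).1 hxy.le (hmem' y hy).2
  have hylab := hz.le_and_idxOf_le (hmem' y hy).1 hyz.le (hmem' z hzu).2
  have key : ∀ a b, ¬ (a = x ∧ b = z) → v.idxOf b < v.idxOf a → u.idxOf b < u.idxOf a ∨
      a = z ∧ b = x := by
    intro a b hab hlt
    have h1 := ht a
    have h2 := ht b
    by_cases a = x <;> by_cases a = y <;> by_cases a = z <;> by_cases b = x <;>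
      by_cases b = y <;> by_cases b = z <;> first | omega | (subst_vars; omega)
  have key' : ∀ a b, ¬ (a = x ∧ b = z) → ChainStep v ℓ a b → ChainStep u ℓ a b := by
    rintro a b hab (h1 | ⟨h1, h2⟩)
    · exact Or.inl h1
    · rcases key a b hab h2 with h2 | ⟨rfl, rfl⟩
      · exact Or.inr ⟨h1, h2⟩
      -- Here `x < z`, so the label of `x` is at most that of `z` and positions do not matter.
      · left
        omega
  rcases hpos with hpos | hpos
  · refine ⟨F, hF.of_step hmem fun i j _ _ hst => ?_⟩
    by_cases hab : F i j = x ∧ F (i + 1) j = z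
    · rw [hab.1, hab.2] at hst ⊢
      rcases hst with h1 | ⟨h1, h2⟩
      · exact Or.inl h1
      · omega
    · exact key' _ _ hab hst
  by_cases hused : ∃ i j, j < ms.getD i 0 ∧ j < ms.getD (i + 1) 0 ∧ F i j = x ∧ F (i + 1) j = z
  swap
  · refine ⟨F, hF.of_step hmem fun i j hi hi' hst => key' _ _ (fun hab => ?_) hst⟩
    exact hused ⟨i, j, hi, hi', hab⟩
  obtain ⟨i₀, j₀, hi, hi', hFx, hFz⟩ := hused
  have hst := hF.step i₀ j₀ hi hi'
  rw [hFx, hFz] at hst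
  -- In `u` the larger letter `z` stands left of `y`, so the labels differ; with `hlx` this squeezes
  -- the label of `x` up to that of `y`.
  have hlz : ℓ y < ℓ z := by
    have := hylab.2
    rcases hylab.1.lt_or_eq with h | h
    · exact h
    · have := this h
      omega
  have hlx : ℓ z ≤ ℓ x + 1 := by
    rcases hst with h | h
    · omega
    · exact h.1
  have hxy' : ℓ x = ℓ y := by omega
  have hsw : ∀ a, ℓ (Equiv.swap x y a) = ℓ a := by
    intro a
    rw [Equiv.swap_apply_def]
    split_ifs with h1 h2
    · rw [h1, hxy']
    · rw [h2, hxy']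
    · rfl
  refine ⟨fun i j => Equiv.swap x y (F i j), fun i j h => ?_, fun i j i' j' h h' he => ?_,
    fun j hj => ?_, fun i j h h' => ?_⟩
  · rw [Equiv.swap_apply_def]
    split_ifs
    · exact hy
    · exact hx
    · exact hmem _ (hF.mem i j h)
  · exact hF.inj i j i' j' h h' ((Equiv.swap x y).injective he)
  · rw [hsw]
    exact hF.start j hj
  -- The exchange would turn this into the bad pair, but `z` occurs once and already lies below `x`.
  · have hyz' : ¬ (F i j = y ∧ F (i + 1) j = z) := by
      rintro ⟨h1, h2⟩
      have h3 := hF.inj _ _ _ _ h' hi' (h2.trans hFz.symm)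
      obtain ⟨h3, rfl⟩ := h3
      obtain rfl : i = i₀ := by omega
      omega
    have hst := hF.step i j h h'
    simp only [ChainStep, hsw] at hst ⊢
    rcases hst with h1 | ⟨h1, h2⟩
    · exact Or.inl h1
    by_cases hle : ℓ (F (i + 1) j) ≤ ℓ (F i j)
    · exact Or.inl hle
    refine Or.inr ⟨h1, ?_⟩
    generalize F i j = a at *
    generalize F (i + 1) j = b at *
    have h3 := ht a
    have h4 := ht b
    simp only [Equiv.swap_apply_def]
    by_cases haz : a = z <;> by_cases hbz : b = z <;> split_ifs <;> subst_vars <;> omega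

theorem KnuthReduces.isCochargeLabeling {u v : List ℕ} (h : KnuthReduces u v) {s len : ℕ}
    {ℓ : ℕ → ℤ} (hu : u.Nodup) (hz : IsCochargeLabeling u s len ℓ) :
    IsCochargeLabeling v s len ℓ := by
  induction h with
  | refl => exact hz
  | tail h1 h ih => exact h.isCochargeLabeling ((KnuthReduces.perm h1).nodup_iff.1 hu) ih

theorem KnuthReduces.exists_isChainFilling {u v : List ℕ} (h : KnuthReduces u v) {s len : ℕ}
    {ℓ : ℕ → ℤ} {ms : List ℕ} (hu : u.Perm (List.range' s len))
    (hz : IsCochargeLabeling u s len ℓ) (hF : ∃ F, IsChainFilling v ℓ ms F) :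
    ∃ F, IsChainFilling u ℓ ms F := by
  induction h with
  | refl => exact hF
  | tail h1 h ih =>
    have hp := KnuthReduces.perm h1
    exact ih (h.exists_isChainFilling (hp.symm.trans hu)
      (KnuthReduces.isCochargeLabeling h1 (hu.nodup_iff.2 List.nodup_range') hz) hF)

/-! ### Catabolism -/

/-- After sorting `r`, both sides are sorted lists with the same letters, hence equal; cut at the
length of `b`. -/
theorem eq_range'_of_perm_append {b r : List ℕ} {s len : ℕ} (h : (b ++ r).Perm (List.range' s len))
    (hb : b.Pairwise (· ≤ ·)) (hbr : ∀ x ∈ b, ∀ y ∈ r, x < y) :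
    b = List.range' s b.length ∧ r.Perm (List.range' (s + b.length) (len - b.length)) := by
  have hR : (r.mergeSort (· ≤ ·)).Perm r := List.mergeSort_perm _ _
  have hsort : (b ++ r.mergeSort (· ≤ ·)).Pairwise (· ≤ ·) :=
    List.pairwise_append.2 ⟨hb, List.pairwise_mergeSort' (· ≤ ·) r,
      fun x hx y hy => (hbr x hx y (hR.mem_iff.1 hy)).le⟩
  have heq := ((hR.append_left b).trans h).eq_of_pairwise' hsort (List.pairwise_le_range' _)
  have hlen : b.length ≤ len := by
    have := h.length_eq
    simp at this
    omega
  constructor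
  · have := congrArg (List.take b.length) heq
    rwa [List.take_left', List.take_range'_of_length_ge hlen] at this
    rfl
  · have := congrArg (List.drop b.length) heq
    rw [List.drop_left' rfl, List.drop_range', mul_one] at this
    exact hR.symm.trans (this ▸ List.Perm.refl _)

/-- The labeling of `c ++ a` obtained from the one of `a ++ range' s m ++ c`. -/
def catLabeling (c : List ℕ) (z : ℕ → ℤ) (x : ℕ) : ℤ :=
  if x ∈ c then z x else z x - 1

theorem idxOf_cat {a c : List ℕ} {s m : ℕ} (hnd : (a ++ List.range' s m ++ c).Nodup) :
    (∀ x ∈ a, x ∉ c ∧ (a ++ List.range' s m ++ c).idxOf x = a.idxOf x ∧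
      (c ++ a).idxOf x = a.idxOf x + c.length ∧ a.idxOf x < a.length) ∧
    (∀ x ∈ c, (a ++ List.range' s m ++ c).idxOf x = c.idxOf x + m + a.length ∧
      (c ++ a).idxOf x = c.idxOf x ∧ c.idxOf x < c.length) ∧
    (∀ i < m, (a ++ List.range' s m ++ c).idxOf (s + i) = i + a.length) := by
  rw [List.append_assoc] at hnd ⊢
  have h1 := List.nodup_append.1 hnd
  have h2 := List.nodup_append.1 h1.2.1
  refine ⟨fun x hx => ?_, fun x hx => ?_, fun i hi => ?_⟩
  · have hc : x ∉ c := fun hc => h1.2.2 x hx x (by simp [hc]) rfl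
    refine ⟨hc, ?_, ?_, List.idxOf_lt_length_iff.2 hx⟩
    · rw [List.idxOf_append, if_pos hx]
    · rw [List.idxOf_append, if_neg hc]
  · have ha : x ∉ a := fun ha => h1.2.2 x ha x (by simp [hx]) rfl
    have hb : x ∉ List.range' s m := fun hb => h2.2.2 x hb x hx rfl
    refine ⟨?_, ?_, List.idxOf_lt_length_iff.2 hx⟩
    · rw [List.idxOf_append, if_neg ha, List.idxOf_append, if_neg hb, List.length_range']
    · rw [List.idxOf_append, if_pos hx]
  · have hb : s + i ∈ List.range' s m := by simp [hi]
    have ha : s + i ∉ a := fun ha => h1.2.2 _ ha _ (by simp [hi]) rfl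
    rw [List.idxOf_append, if_neg ha, List.idxOf_append, if_pos hb]
    have := List.nodup_range' (s := s) (n := m) (step := 1)
    have h3 := this.idxOf_getElem i (by simpa using hi)
    simp only [List.getElem_range', one_mul] at h3
    rw [h3]

theorem IsCochargeLabeling.eq_zero {a c : List ℕ} {s m len : ℕ} {z : ℕ → ℤ}
    (hnd : (a ++ List.range' s m ++ c).Nodup)
    (hz : IsCochargeLabeling (a ++ List.range' s m ++ c) s len z) (hm : m ≤ len) :
    ∀ i < m, z (s + i) = 0 := by
  intro i hi
  have h := (idxOf_cat hnd).2.2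
  induction i with
  | zero => exact hz.start (by omega)
  | succ i ih =>
    have h1 := h i (by omega)
    have h2 := h (i + 1) hi
    rw [← add_assoc] at h2 ⊢
    rw [hz.succ (s + i) (by omega) (by omega), ih (by omega), if_neg (by omega)]
    rfl

/-- Orders within `a` and within `c` persist. Between `a` and `c` the order flips, and the shift by
1 on `a` compensates for this. -/
theorem IsCochargeLabeling.cat {a c : List ℕ} {s m len : ℕ} {z : ℕ → ℤ} (hm : 0 < m)
    (hlen : m ≤ len) (hnd : (a ++ List.range' s m ++ c).Nodup)
    (hp : (c ++ a).Perm (List.range' (s + m) (len - m)))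
    (hz : IsCochargeLabeling (a ++ List.range' s m ++ c) s len z) :
    IsCochargeLabeling (c ++ a) (s + m) (len - m) (catLabeling c z) := by
  obtain ⟨ha, hc, hb⟩ := idxOf_cat hnd
  have hmem : ∀ x, s + m ≤ x → x < s + len → x ∈ c ∨ x ∈ a := fun x h1 h2 =>
    List.mem_append.1 (hp.mem_iff.2 (by simp only [List.mem_range'_1]; omega))
  constructor
  · intro hpos
    -- The last letter of the removed interval has label 0, so `s + m` has label 0 in `c` and 1 in
    -- `a`.
    have h0 := hz.eq_zero hnd hlen (m - 1) (by omega)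
    have h1 := hz.succ (s + (m - 1)) (by omega) (by omega)
    have h2 := hb (m - 1) (by omega)
    rw [show s + (m - 1) + 1 = s + m by omega] at h1
    rcases hmem (s + m) le_rfl (by omega) with h | h
    · rw [catLabeling, if_pos h, h1, h0, if_neg (by have := hc _ h; omega)]
      rfl
    · rw [catLabeling, if_neg (ha _ h).1, h1, h0, if_pos (by have := ha _ h; omega)]
      rfl
  · intro i hi hi'
    have h1 := hz.succ i (by omega) (by omega)
    unfold catLabeling
    rcases hmem i hi (by omega) with h | h <;> rcases hmem (i + 1) (by omega) (by omega) with h' | h'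
    · have h2 := hc _ h
      have h3 := hc _ h'
      simp only [h, h', if_true]
      split_ifs at h1 ⊢ <;> omega
    · have h2 := hc _ h
      have h3 := ha _ h'
      simp only [h, h3.1, if_true, if_false]
      split_ifs at h1 ⊢ <;> omega
    · have h2 := ha _ h
      have h3 := hc _ h'
      simp only [h2.1, h', if_true, if_false]
      split_ifs at h1 ⊢ <;> omega
    · have h2 := ha _ h
      have h3 := ha _ h'
      simp only [h2.1, h3.1, if_false]
      split_ifs at h1 ⊢ <;> omega

/-- From `c` to `a`, the old label may exceed by one, but `a` now lies to the left; from `a` to `c`,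
the old label cannot rise. -/
theorem ChainStep.of_cat {a c : List ℕ} {s m : ℕ} {z : ℕ → ℤ}
    (hnd : (a ++ List.range' s m ++ c).Nodup) {x y : ℕ} (hx : x ∈ c ++ a) (hy : y ∈ c ++ a)
    (h : ChainStep (c ++ a) (catLabeling c z) x y) :
    ChainStep (a ++ List.range' s m ++ c) z x y := by
  obtain ⟨ha, hc, -⟩ := idxOf_cat hnd
  unfold ChainStep catLabeling at *
  rcases List.mem_append.1 hx with hx | hx <;> rcases List.mem_append.1 hy with hy | hy
  · have h2 := hc _ hx
    have h3 := hc _ hy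
    simp only [hx, hy, if_true] at h
    omega
  · have h2 := hc _ hx
    have h3 := ha _ hy
    simp only [hx, h3.1, if_true, if_false] at h
    omega
  · have h2 := ha _ hx
    have h3 := hc _ hy
    simp only [h2.1, hy, if_true, if_false] at h
    omega
  · have h2 := ha _ hx
    have h3 := ha _ hy
    simp only [h2.1, h3.1, if_false] at h
    omega

theorem IsChainFilling.cons {a c : List ℕ} {s m len : ℕ} {z : ℕ → ℤ} {ms : List ℕ}
    {F : ℕ → ℕ → ℕ} (hlen : m ≤ len)
    (hnd : (a ++ List.range' s m ++ c).Nodup)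
    (hp : (c ++ a).Perm (List.range' (s + m) (len - m)))
    (hz : IsCochargeLabeling (a ++ List.range' s m ++ c) s len z)
    (hF : IsChainFilling (c ++ a) (catLabeling c z) ms F) :
    IsChainFilling (a ++ List.range' s m ++ c) z (m :: ms)
      (consFilling s F) := by
  obtain ⟨ha, hc, hb⟩ := idxOf_cat hnd
  have hz0 := hz.eq_zero hnd hlen
  have hge : ∀ i j, j < ms.getD i 0 → s + m ≤ F i j := fun i j h => by
    have := hp.mem_iff.1 (hF.mem i j h)
    simp only [List.mem_range'_1] at this
    exact this.1
  constructor
  · rintro (_ | i) j h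
    · simp only [List.getD_cons_zero] at h
      simp [consFilling, h]
    · have := hF.mem i j (by simpa using h)
      simp only [List.mem_append, consFilling] at this ⊢
      tauto
  · rintro (_ | i) j (_ | i') j' h h' he <;>
      simp only [List.getD_cons_zero, List.getD_cons_succ, consFilling] at h h' he
    · omega
    · have := hge _ _ h'
      omega
    · have := hge _ _ h
      omega
    · have := hF.inj i j i' j' h h' he
      omega
  · intro j h
    exact hz0 j (by simpa using h)
  · rintro (_ | i) j h h' <;> simp only [List.getD_cons_zero, List.getD_cons_succ, consFilling] at h h' ⊢
    -- The letter below has new label 0: its old label is 0 in `c`, or 1 in `a`, which lies left of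
    -- the interval.
    · have h1 := hF.start j h'
      have h2 := hz0 j h
      have h3 := hb j h
      unfold catLabeling at h1
      unfold ChainStep
      rcases List.mem_append.1 (hF.mem 0 j h') with h4 | h4
      · rw [if_pos h4] at h1
        omega
      · have h5 := ha _ h4
        rw [if_neg h5.1] at h1
        omega
    · exact (hF.step i j h h').of_cat hnd (hF.mem i j h) (hF.mem (i + 1) j h')

theorem exists_isChainFilling {ms : List ℕ}
    (hpos : ∀ m ∈ ms, 0 < m) {w : List ℕ} {s len : ℕ} {z : ℕ → ℤ}
    (hw : w.Perm (List.range' s len)) (hz : IsCochargeLabeling w s len z)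
    (hcat : IsCatabolizable (insertionTableau w) ms) : ∃ F, IsChainFilling w z ms F := by
  induction ms generalizing w s len z with
  | nil => exact ⟨fun _ _ => 0, by simp, by simp, by simp, by simp⟩
  | cons m ms ih =>
    have hred := knuthReduces_rowWord_insertionTableau w
    refine hred.exists_isChainFilling hw hz ?_
    have hz' := hred.isCochargeLabeling (hw.nodup_iff.2 List.nodup_range') hz
    have hw' := hred.perm.symm.trans hw
    have hrow : ((insertionTableau w).headD []).Pairwise (· ≤ ·) := by
      have := insertionTableau_sorted w
      cases hT : insertionTableau w with
      | nil => simp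
      | cons r rs => exact this r (by simp [hT])
    obtain ⟨hm, hlt, hcat⟩ := hcat
    generalize insertionTableau w = T at *
    have hTw : rowWord T = rowWord (southPart T) ++ firstRowTake m T ++ northPart m T := by
      rw [List.append_assoc, firstRowTake, northPart, List.take_append_drop]
      cases T with
      | nil => simp [southPart]
      | cons r rs => simp [southPart, rowWord_cons]
    have hlen : (firstRowTake m T).length = m := by
      rw [firstRowTake, List.length_take, min_eq_left hm]
    rw [hTw] at hz' hw' ⊢
    unfold cat at hcat
    generalize rowWord (southPart T) = a at *
    generalize northPart m T = c at *
    have hp : (firstRowTake m T ++ (c ++ a)).Perm (List.range' s len) := by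
      refine List.Perm.trans ?_ hw'
      rw [List.append_assoc, ← List.append_assoc (firstRowTake m T)]
      exact List.perm_append_comm
    have hb := eq_range'_of_perm_append hp (hrow.sublist (List.take_sublist _ _)) hlt
    rw [hlen] at hb
    rw [hb.1] at hz' hw' ⊢
    have hnd := hw'.nodup_iff.2 List.nodup_range'
    have hmlen : m ≤ len := by
      have := hp.length_eq
      simp only [List.length_append, List.length_range', hlen] at this
      omega
    obtain ⟨F, hF⟩ := ih (fun k hk => hpos k (by simp [hk])) hb.2
      (hz'.cat (hpos m (by simp)) hmlen hnd hb.2) hcat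
    exact ⟨_, hF.cons hmlen hnd hb.2 hz'⟩

/-! ### Chains of positions -/

theorem isCochargeLabeling_cochargeLabel (w : List ℕ) (n : ℕ) :
    IsCochargeLabeling w 1 n (fun a => (cochargeLabel w a : ℤ)) := by
  refine ⟨fun _ => by simp [cochargeLabel], fun i hi _ => ?_⟩
  obtain ⟨i, rfl⟩ := Nat.exists_eq_add_of_le' hi
  rw [cochargeLabel]
  split_ifs <;> simp

/-- The integer at most `n` at which `w̃` has the value `i` because of the letter `a` of `w`. -/
def chainPosition (n : ℕ) (w : List ℕ) (i a : ℕ) : ℤ :=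
  (w.idxOf a : ℤ) + 1 - ((i : ℤ) - cochargeLabel w a) * n

/-- The window shift is `i` minus the label of `a`, which tops the label up to `i`. -/
theorem tilde_chainPosition {n : ℕ} {w : List ℕ} (hw : IsStandardWord n w) {a : ℕ} (ha : a ∈ w)
    (i : ℕ) : tilde n w (chainPosition n w i a) = i := by
  have hlen : w.length = n := by simpa using hw.length_eq
  have hidx := List.idxOf_lt_length_iff.2 ha
  have hs : (i : ℤ) - cochargeLabel w a = windowShift n (chainPosition n w i a) := by
    rw [← windowShift_spec (by omega)]
    unfold chainPosition
    constructor <;> linarith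
  have hi : (chainPosition n w i a + windowShift n (chainPosition n w i a) * n - 1).toNat
      = w.idxOf a := by
    rw [← hs, chainPosition, sub_add_cancel, add_sub_cancel_right, Int.toNat_natCast]
  rw [tilde, hi, ← hs, cochargeLabeling]
  simp [List.getD_eq_getElem?_getD, hidx]

theorem chainPosition_cast (n : ℕ) (w : List ℕ) (i a : ℕ) :
    (chainPosition n w i a : ZMod n) = ((w.idxOf a + 1 : ℕ) : ZMod n) := by
  simp [chainPosition]

theorem chainPosition_residue_inj {n : ℕ} {w : List ℕ} (hw : IsStandardWord n w) {i i' a a' : ℕ}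
    (ha : a ∈ w) (ha' : a' ∈ w)
    (h : (chainPosition n w i a : ZMod n) = (chainPosition n w i' a' : ZMod n)) : a = a' := by
  have hlen : w.length = n := by simpa using hw.length_eq
  have hidx := List.idxOf_lt_length_iff.2 ha
  have hidx' := List.idxOf_lt_length_iff.2 ha'
  rw [chainPosition_cast, chainPosition_cast, ZMod.natCast_eq_natCast_iff] at h
  have h1 := Nat.ModEq.add_right_cancel' 1 h
  have h2 := h1.eq_of_lt_of_lt (by omega) (by omega)
  exact (List.idxOf_inj ha).1 h2

/-- If the label does not rise, the shift grows by a full window, more than positions can differ;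
otherwise the shift does not shrink and the position drops. -/
theorem chainPosition_lt {n : ℕ} {w : List ℕ} (hw : IsStandardWord n w) {i a b : ℕ} (hb : b ∈ w)
    (ha : a ∈ w) (h : ChainStep w (fun a => (cochargeLabel w a : ℤ)) a b) :
    chainPosition n w (i + 1) b < chainPosition n w i a := by
  have hlen : w.length = n := by simpa using hw.length_eq
  have hidx := List.idxOf_lt_length_iff.2 ha
  have hidx' := List.idxOf_lt_length_iff.2 hb
  unfold chainPosition
  push_cast
  have hn : (0 : ℤ) ≤ n := by positivity
  rcases h with h | ⟨h1, h2⟩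
  · have : ((i : ℤ) - cochargeLabel w a + 1) * n ≤ ((i : ℤ) + 1 - cochargeLabel w b) * n :=
      mul_le_mul_of_nonneg_right (by linarith) hn
    have h3 : (w.idxOf b : ℤ) < n := by omega
    have h4 : (0 : ℤ) ≤ w.idxOf a := by positivity
    linarith
  · have : ((i : ℤ) - cochargeLabel w a) * n ≤ ((i : ℤ) + 1 - cochargeLabel w b) * n :=
      mul_le_mul_of_nonneg_right (by linarith) hn
    have h3 : (w.idxOf b : ℤ) < w.idxOf a := by exact_mod_cast h2
    linarith

/-- The default 0 agrees with the length of rows beyond the diagram. -/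
theorem getD_rowLens (lam : YoungDiagram) (i : ℕ) : lam.rowLens.getD i 0 = lam.rowLen i := by
  by_cases h : i < lam.rowLens.length
  · rw [List.getD_eq_getElem _ _ h, YoungDiagram.get_rowLens]
  · rw [List.getD_eq_default _ _ (by omega)]
    rw [YoungDiagram.length_rowLens, ← YoungDiagram.mem_iff_lt_colLen,
      YoungDiagram.mem_iff_lt_rowLen] at h
    omega

/-- The column `j` of a filling, read upwards and translated into positions. -/
def columnChain (n : ℕ) (w : List ℕ) (F : ℕ → ℕ → ℕ) (len j : ℕ) : List ℤ :=
  ((List.range len).map fun i => chainPosition n w i (F i j)).reverse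

theorem mem_columnChain {n : ℕ} {w : List ℕ} {F : ℕ → ℕ → ℕ} {len j : ℕ} {x : ℤ} :
    x ∈ columnChain n w F len j ↔ ∃ i < len, chainPosition n w i (F i j) = x := by
  simp [columnChain]

/-! ### Columns of a filling as chains with disjoint residues -/

section Columns

variable {n : ℕ} {w : List ℕ} {lam : YoungDiagram} {F : ℕ → ℕ → ℕ}

theorem IsChainFilling.chainPosition_strictAnti (hw : IsStandardWord n w)
    (hF : IsChainFilling w (fun a => (cochargeLabel w a : ℤ)) lam.rowLens F) {i i' j : ℕ}
    (hii : i < i') (hi' : i' < lam.colLen j) :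
    chainPosition n w i' (F i' j) < chainPosition n w i (F i j) := by
  have hlt : ∀ i, i < lam.colLen j → j < lam.rowLens.getD i 0 := fun i h => by
    rwa [getD_rowLens, ← YoungDiagram.mem_iff_lt_rowLen, YoungDiagram.mem_iff_lt_colLen]
  induction i', hii using Nat.le_induction with
  | base =>
    have h1 := hlt i (by omega)
    have h2 := hlt (i + 1) hi'
    exact chainPosition_lt hw (hF.mem _ _ h2) (hF.mem _ _ h1) (hF.step i j h1 h2)
  | succ k hk ih =>
    have h1 := hlt k (by omega)
    have h2 := hlt (k + 1) hi'
    exact (chainPosition_lt hw (hF.mem _ _ h2) (hF.mem _ _ h1) (hF.step k j h1 h2)).trans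
      (ih (by omega))

theorem IsChainFilling.isChainOf (hw : IsStandardWord n w)
    (hF : IsChainFilling w (fun a => (cochargeLabel w a : ℤ)) lam.rowLens F) {j : ℕ}
    (hj : j < lam.rowLen 0) :
    IsChainOf n (tilde n w) (columnChain n w F (lam.colLen j) j) := by
  have hlt : ∀ i, i < lam.colLen j → j < lam.rowLens.getD i 0 := fun i h => by
    rwa [getD_rowLens, ← YoungDiagram.mem_iff_lt_rowLen, YoungDiagram.mem_iff_lt_colLen]
  have hcol : 0 < lam.colLen j := by
    rwa [← YoungDiagram.mem_iff_lt_colLen, YoungDiagram.mem_iff_lt_rowLen]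
  have hlen : w.length = n := by simpa using hw.length_eq
  constructor
  · intro h
    have := congrArg List.length h
    simp [columnChain] at this
    omega
  · intro x hx
    obtain ⟨i, hi, rfl⟩ := mem_columnChain.1 hx
    -- Label 0 in row 0 means no shift, so this is a position in `[1, n]`.
    have h0 : chainPosition n w 0 (F 0 j) ≤ n := by
      have h1 := hF.start j (hlt 0 hcol)
      have h2 := List.idxOf_lt_length_iff.2 (hF.mem 0 j (hlt 0 hcol))
      rw [chainPosition, h1, Nat.cast_zero, sub_zero, zero_mul, sub_zero]
      linarith [(by exact_mod_cast hlen ▸ h2 : ((w.idxOf (F 0 j) : ℤ)) + 1 ≤ n)]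
    rcases Nat.eq_zero_or_pos i with rfl | hi0
    · exact h0
    · exact (hF.chainPosition_strictAnti hw hi0 hi).le.trans h0
  · rw [columnChain, List.pairwise_reverse, List.pairwise_map]
    refine List.Pairwise.imp_of_mem ?_ List.pairwise_lt_range
    intro i i' _ hi' hii
    exact hF.chainPosition_strictAnti hw hii (List.mem_range.1 hi')
  · rw [columnChain, List.reverse_reverse, List.map_map, List.length_reverse, List.length_map,
      List.length_range]
    refine List.map_congr_left fun i hi => ?_
    exact tilde_chainPosition hw (hF.mem i j (hlt i (List.mem_range.1 hi))) i
  -- The cast to `ZMod n` acts on the list through its monad structure; this makes it a plain map.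
  · simp only [List.bind_eq_flatMap, List.pure_def, List.map_id',
      ← List.map_eq_flatMap]
    rw [columnChain, List.map_reverse, List.nodup_reverse, List.map_map]
    refine List.Nodup.map_on ?_ List.nodup_range
    intro i hi i' hi' h
    have h1 := hlt i (List.mem_range.1 hi)
    have h2 := hlt i' (List.mem_range.1 hi')
    exact (hF.inj _ _ _ _ h1 h2
      (chainPosition_residue_inj hw (hF.mem _ _ h1) (hF.mem _ _ h2) h)).1

theorem IsChainFilling.disjoint_residues (hw : IsStandardWord n w)
    (hF : IsChainFilling w (fun a => (cochargeLabel w a : ℤ)) lam.rowLens F) {j j' : ℕ}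
    (hjj : j ≠ j') :
    Disjoint (residues n (columnChain n w F (lam.colLen j) j))
      (residues n (columnChain n w F (lam.colLen j') j')) := by
  have hlt : ∀ i j, i < lam.colLen j → j < lam.rowLens.getD i 0 := fun i j h => by
    rwa [getD_rowLens, ← YoungDiagram.mem_iff_lt_rowLen, YoungDiagram.mem_iff_lt_colLen]
  rw [Set.disjoint_left]
  rintro r ⟨x, hx, hxr⟩ ⟨y, hy, hyr⟩
  obtain ⟨i, hi, rfl⟩ := mem_columnChain.1 hx
  obtain ⟨i', hi', rfl⟩ := mem_columnChain.1 hy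
  have h1 := hlt i j hi
  have h2 := hlt i' j' hi'
  exact hjj (hF.inj _ _ _ _ h1 h2
    (chainPosition_residue_inj hw (hF.mem _ _ h1) (hF.mem _ _ h2) (hxr.trans hyr.symm))).2

end Columns

end Catabolism

/-- If `ctype(w) = λ`, then `w̃` has an `ℓ(λ)`-bounded chain family whose chains have lengths
`λ'_1, …, λ'_{λ_1}` (the row lengths of the transpose of `λ`, as a multiset). -/
theorem mainTheorem7 (n : ℕ) (w : List ℕ) (hw : Catabolism.IsStandardWord n w)
    (lam : YoungDiagram) (hlam : Catabolism.CtypeEq w lam) :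
    ∃ A : Finset (List ℤ),
      Catabolism.IsBoundedChainFamily n (Catabolism.tilde n w) lam.rowLens.length A ∧
      A.val.map List.length = (lam.transpose.rowLens : Multiset ℕ) := by
  obtain ⟨F, hF⟩ := Catabolism.exists_isChainFilling
    lam.pos_of_mem_rowLens hw (Catabolism.isCochargeLabeling_cochargeLabel w n) hlam.1
  -- Distinct columns have disjoint nonempty residue sets, so no chain is lost when they are
  -- collected in a `Finset`.
  have hinj : Set.InjOn (fun j => Catabolism.columnChain n w F (lam.colLen j) j)
      (Finset.range (lam.rowLen 0) : Set ℕ) := by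
    intro j hj j' _ h
    by_contra hjj
    have hd := hF.disjoint_residues hw hjj
    simp only at h
    rw [← h, disjoint_self] at hd
    have hcol : 0 < lam.colLen j := by
      rw [← YoungDiagram.mem_iff_lt_colLen, YoungDiagram.mem_iff_lt_rowLen]
      simpa using hj
    exact Set.eq_empty_iff_forall_notMem.1 hd _
      ⟨_, Catabolism.mem_columnChain.2 ⟨0, hcol, rfl⟩, rfl⟩
  refine ⟨(Finset.range (lam.rowLen 0)).image
    fun j => Catabolism.columnChain n w F (lam.colLen j) j, ⟨?_, ?_, ?_⟩, ?_⟩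
  · intro c hc
    obtain ⟨j, hj, rfl⟩ := Finset.mem_image.1 hc
    exact hF.isChainOf hw (Finset.mem_range.1 hj)
  · intro c hc
    obtain ⟨j, hj, rfl⟩ := Finset.mem_image.1 hc
    rw [YoungDiagram.length_rowLens]
    simpa [Catabolism.columnChain] using lam.colLen_anti 0 j (Nat.zero_le j)
  · intro c hc c' hc' hne
    obtain ⟨j, hj, rfl⟩ := Finset.mem_image.1 hc
    obtain ⟨j', hj', rfl⟩ := Finset.mem_image.1 hc'
    exact hF.disjoint_residues hw fun h => hne (by rw [h])
  · rw [Finset.image_val_of_injOn hinj, Multiset.map_map, YoungDiagram.rowLens,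
      YoungDiagram.colLen_transpose, Finset.range_val, ← Multiset.coe_range, Multiset.map_coe]
    congr 1
    refine List.map_congr_left fun j _ => ?_
    simp [Catabolism.columnChain]
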